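/- Let $\mathcal X,\mathcal Y$ be Euclidean spaces, let $\mathcal S^n$ be the space of real symmetric $n\times n$ matrices with the Frobenius inner product, with cones $\mathcal S^n_+$, $\mathcal S^n_-$ of positive and negative semidefinite matrices, and let $f:\mathcal X\to\mathbb R$, $h:\mathcal X\to\mathcal Y$, $G:\mathcal X\to\mathcal S^n$ be twice continuously differentiable. Consider the problem of minimizing $f(x)$ subject to $h(x)=0$, $G(x)\in\mathcal S^n_+$. For $\lambda=(y,\Gamma)\in\mathcal Y\times\mathcal S^n$ (with the Euclidean product norm) and $\rho>0$ put $$L(x,\lambda)=f(x)+\langle y,h(x)\rangle+\langle\Gamma,G(x)\rangle,\qquad \mathscr L(x,\lambda,\rho)=f(x)+\frac{\rho}{2}\,\mathrm{dist}^2\Big((h(x),G(x))+\frac{\lambda}{\rho},\ \{0\}\times\mathcal S^n_+\Big)-\frac{\|\lambda\|^2}{2\rho}.$$ Let $\mathcal M(x)$ be the set of all $\lambda=(y,\Gamma)$ with $\nabla_xL(x,\lambda)=0$, $h(x)=0$, $G(x)\in\mathcal S^n_+$, $\Gamma\in\mathcal S^n_-$, $\langle G(x),\Gamma\rangle=0$;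 a point $x$ is called stationary if $\mathcal M(x)\neq\emptyset$. For a set $C$, let $T_C(z)$ be the Bouligand tangent cone, i.e. the set of all $d$ for which there are $t_k\downarrow0$, $d_k\to d$ with $z+t_kd_k\in C$ for all $k$. We say that the second order sufficient condition (SOSC) holds at $(\bar x,\bar\lambda)$, $\bar\lambda=(\bar y,\bar\Gamma)\in\mathcal M(\bar x)$, if $$\langle\nabla^2_{xx}L(\bar x,\bar\lambda)d,d\rangle-2\big\langle\bar\Gamma,\,(\nabla G(\bar x)d)\,G(\bar x)^\dagger\,(\nabla G(\bar x)d)\big\rangle>0$$ for every $d\neq0$ with $\nabla h(\bar x)d=0$, $\nabla G(\bar x)d\in T_{\mathcal S^n_+}(G(\bar x))$ and $\langle\bar\Gamma,\nabla G(\bar x)d\rangle=0$, where $G(\bar x)^\dagger$ is the Moore-Penrose inverse. For $\varphi:\mathcal X\to\mathbb R$ the subderivative and the second semiderivative at $x$ are the extended real numbers $$\mathrm d\varphi(x)(w)=\liminf_{t\downarrow0,\,w'\to w}\frac{\varphi(x+tw')-\varphi(x)}{t},\qquad \mathrm d^2\varphi(x)(w)=\liminf_{t\downarrow0,\,w'\to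 w}\frac{\varphi(x+tw')-\varphi(x)-t\,\mathrm d\varphi(x)(w')}{\frac12t^2},$$ and $\mathrm d^2_x\mathscr L(\bar x,\lambda,\rho)$ denotes the second semiderivative of $\mathscr L(\cdot,\lambda,\rho)$ at $\bar x$. Let $\bar x$ be a stationary point and $\bar\lambda\in\mathcal M(\bar x)$. Then the following are equivalent: (a) SOSC holds at $(\bar x,\bar\lambda)$; (b) there are constants $\rho_3,\varepsilon',l'>0$ such that for all $\lambda\in\mathcal M(\bar x)$ with $\|\lambda-\bar\lambda\|\le\varepsilon'$ and all $\rho\ge\rho_3$, $$\mathrm d^2_x\mathscr L(\bar x,\lambda,\rho)(w)\ \ge\ l'\|w\|^2\qquad\text{for all } w\in\mathcal X\setminus\{0\}.$$ -/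

import Mathlib

open Filter Topology Matrix

namespace NLSDP

/-! ## The Euclidean space of real symmetric matrices -/

/-- The linear subspace of symmetric matrices among all real `n × n` matrices. -/
def symSubmodule (n : ℕ) : Submodule ℝ (Matrix (Fin n) (Fin n) ℝ) where
  carrier := {A | A.IsSymm}
  zero_mem' := Matrix.isSymm_zero
  add_mem' := fun hA hB => hA.add hB
  smul_mem' := fun c _ hA => hA.smul c

/-- The space `𝒮ⁿ` of real symmetric `n × n` matrices. It is made a definition (not an
abbreviation) so that its only norm and topology are the Frobenius ones declared below. -/
def SymMat (n : ℕ) : Type := symSubmodule n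

/-- The underlying matrix of an element of `𝒮ⁿ`. -/
def SymMat.mat {n : ℕ} (A : SymMat n) : Matrix (Fin n) (Fin n) ℝ := Subtype.val A

instance (n : ℕ) : AddCommGroup (SymMat n) := inferInstanceAs (AddCommGroup (symSubmodule n))

noncomputable instance (n : ℕ) : Module ℝ (SymMat n) :=
  inferInstanceAs (Module ℝ (symSubmodule n))

instance (n : ℕ) : FiniteDimensional ℝ (SymMat n) :=
  inferInstanceAs (FiniteDimensional ℝ (symSubmodule n))

theorem SymMat.isSymm {n : ℕ} (A : SymMat n) : A.mat.IsSymm := A.2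

theorem SymMat.isHermitian {n : ℕ} (A : SymMat n) : A.mat.IsHermitian := by
  have h := A.isSymm
  rwa [Matrix.IsSymm, ← Matrix.conjTranspose_eq_transpose_of_trivial] at h

/-- The Frobenius inner product `⟨A, B⟩ = trace (AᵀB)` of two matrices. -/
noncomputable def frob {n : ℕ} (A B : Matrix (Fin n) (Fin n) ℝ) : ℝ := (Aᵀ * B).trace

/-- `𝒮ⁿ` carries the Frobenius inner product. -/
@[reducible]
noncomputable def frobCore (n : ℕ) : InnerProductSpace.Core ℝ (SymMat n) where
  inner A B := frob A.mat B.mat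
  conj_inner_symm A B := by
    show (B.matᵀ * A.mat).trace = (A.matᵀ * B.mat).trace
    rw [← Matrix.trace_transpose (B.matᵀ * A.mat), Matrix.transpose_mul,
      Matrix.transpose_transpose]
  re_inner_nonneg A := by
    have h : (0 : ℝ) ≤ (A.matᴴ * A.mat).trace :=
      (Matrix.posSemidef_conjTranspose_mul_self A.mat).trace_nonneg
    rwa [Matrix.conjTranspose_eq_transpose_of_trivial] at h
  add_left A B C := by
    show ((A.mat + B.mat)ᵀ * C.mat).trace = (A.matᵀ * C.mat).trace + (B.matᵀ * C.mat).trace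
    rw [Matrix.transpose_add, Matrix.add_mul, Matrix.trace_add]
  smul_left A B r := by
    show ((r • A.mat)ᵀ * B.mat).trace = r * (A.matᵀ * B.mat).trace
    rw [Matrix.transpose_smul, Matrix.smul_mul, Matrix.trace_smul, smul_eq_mul]
  definite A h := by
    have h' : (A.matᴴ * A.mat).trace = 0 := by
      rw [Matrix.conjTranspose_eq_transpose_of_trivial]; exact h
    exact Subtype.ext (Matrix.trace_conjTranspose_mul_self_eq_zero_iff.1 h')

noncomputable instance (n : ℕ) : NormedAddCommGroup (SymMat n) :=
  (frobCore n).toNormedAddCommGroup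

noncomputable instance (n : ℕ) : InnerProductSpace ℝ (SymMat n) :=
  InnerProductSpace.ofCore (frobCore n).toCore

/-- The cone `𝒮ⁿ₊` of positive semidefinite matrices. -/
def psdCone (n : ℕ) : Set (SymMat n) := {A | A.mat.PosSemidef}

/-- The cone `𝒮ⁿ₋` of negative semidefinite matrices. -/
def nsdCone (n : ℕ) : Set (SymMat n) := {A | (-A.mat).PosSemidef}

/-- The Moore-Penrose generalized inverse `A†` of a symmetric matrix: in an orthonormal basis of
eigenvectors, the nonzero eigenvalues are inverted and the zero eigenvalues are kept
(recall that `0⁻¹ = 0` in Lean). -/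
noncomputable def pinv {n : ℕ} (A : SymMat n) : Matrix (Fin n) (Fin n) ℝ :=
  (A.isHermitian.eigenvectorUnitary : Matrix (Fin n) (Fin n) ℝ) *
    Matrix.diagonal (fun i => (A.isHermitian.eigenvalues i)⁻¹) *
    (A.isHermitian.eigenvectorUnitary : Matrix (Fin n) (Fin n) ℝ)ᵀ

/-! ## Variational analysis -/

section Variational

variable {E : Type*} [NormedAddCommGroup E] [InnerProductSpace ℝ E]

/-- The Bouligand tangent (contingent) cone of `C` at `x`. -/
def tangentCone (C : Set E) (x : E) : Set E :=
  {d | ∃ (t : ℕ → ℝ) (v : ℕ → E), (∀ k, 0 < t k) ∧ Tendsto t atTop (𝓝 0) ∧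
    Tendsto v atTop (𝓝 d) ∧ ∀ k, x + t k • v k ∈ C}

/-- The critical cone `T_C(x) ∩ y^⊥` of `C` at `x` associated with the normal vector `y`. -/
def criticalCone (C : Set E) (x y : E) : Set E :=
  {d | d ∈ tangentCone C x ∧ inner ℝ y d = 0}

/-- The subderivative `df(x)(w) = liminf_{t ↓ 0, w' → w} (f(x + t w') - f(x)) / t`, an extended
real number. -/
noncomputable def subderiv (f : E → ℝ) (x w : E) : EReal :=
  liminf (fun p : ℝ × E => (((f (x + p.1 • p.2) - f x) / p.1 : ℝ) : EReal)) (𝓝[>] 0 ×ˢ 𝓝 w)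

/-- The second semiderivative
`d²f(x)(w) = liminf_{t ↓ 0, w' → w} (f(x + t w') - f(x) - t df(x)(w')) / (t² / 2)`, an extended
real number. -/
noncomputable def secondSemideriv (f : E → ℝ) (x w : E) : EReal :=
  liminf (fun p : ℝ × E =>
      (((f (x + p.1 • p.2) - f x : ℝ) : EReal) - (p.1 : EReal) * subderiv f x p.2) /
        ((p.1 ^ 2 / 2 : ℝ) : EReal))
    (𝓝[>] 0 ×ˢ 𝓝 w)

end Variational

/-! ## The nonlinear semidefinite program `min f(x)` subject to `h(x) = 0`, `G(x) ∈ 𝒮ⁿ₊` -/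

section Program

variable {X Y : Type*} [NormedAddCommGroup X] [InnerProductSpace ℝ X]
  [NormedAddCommGroup Y] [InnerProductSpace ℝ Y] {n : ℕ}

variable (Y n) in
/-- The Euclidean product space `Y × 𝒮ⁿ` in which the multipliers `λ = (y, Γ)` live. -/
abbrev Dual := WithLp 2 (Y × SymMat n)

/-- The Lagrangian `L(x, y, Γ) = f(x) + ⟨y, h(x)⟩ + ⟨Γ, G(x)⟩`. -/
noncomputable def lagrangian (f : X → ℝ) (h : X → Y) (G : X → SymMat n)
    (x : X) (lam : Dual Y n) : ℝ :=
  f x + inner ℝ lam.fst (h x) + inner ℝ lam.snd (G x)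

/-- The constraint mapping `Φ(x) = (h(x), G(x))`. -/
noncomputable def constraintMap (h : X → Y) (G : X → SymMat n) (x : X) : Dual Y n :=
  WithLp.toLp 2 (h x, G x)

variable (Y n) in
/-- The closed convex cone `𝒦 = {0} × 𝒮ⁿ₊`. -/
def constraintCone : Set (Dual Y n) := {z | z.fst = 0 ∧ z.snd ∈ psdCone n}

/-- The augmented Lagrangian
`ℒ(x, λ, ρ) = f(x) + (ρ / 2) dist²(Φ(x) + λ / ρ, 𝒦) - ‖λ‖² / (2 ρ)`. -/
noncomputable def augLagrangian (f : X → ℝ) (h : X → Y) (G : X → SymMat n)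
    (x : X) (lam : Dual Y n) (ρ : ℝ) : ℝ :=
  f x + ρ / 2 * Metric.infDist (constraintMap h G x + ρ⁻¹ • lam) (constraintCone Y n) ^ 2
    - ‖lam‖ ^ 2 / (2 * ρ)

/-- The set `ℳ(x)` of all multipliers `λ = (y, Γ)` that satisfy, together with `x`, the
Karush-Kuhn-Tucker conditions `∇ₓL(x, y, Γ) = 0`, `h(x) = 0`, `𝒮ⁿ₊ ∋ G(x) ⊥ Γ ∈ 𝒮ⁿ₋`. -/
def multipliers (f : X → ℝ) (h : X → Y) (G : X → SymMat n) (x : X) : Set (Dual Y n) :=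
  {lam | fderiv ℝ (fun x' => lagrangian f h G x' lam) x = 0 ∧ h x = 0 ∧
    G x ∈ psdCone n ∧ inner ℝ (G x) lam.snd = 0 ∧ lam.snd ∈ nsdCone n}

/-- A stationary point of the program: a point that admits a multiplier. -/
def IsStationary (f : X → ℝ) (h : X → Y) (G : X → SymMat n) (x : X) : Prop :=
  (multipliers f h G x).Nonempty

/-- The critical cone of the program at `x`, expressed with a matrix multiplier `Γ`. -/
def programCriticalCone (h : X → Y) (G : X → SymMat n) (x : X) (Γ : SymMat n) : Set X :=
  {d | fderiv ℝ h x d = 0 ∧ fderiv ℝ G x d ∈ criticalCone (psdCone n) (G x) Γ}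

/-- The sigma term `Υ_A(Γ, D) = 2 ⟨Γ, D A† D⟩`. -/
noncomputable def sigmaTerm (A Γ D : SymMat n) : ℝ :=
  2 * frob Γ.mat (D.mat * pinv A * D.mat)

/-- The second order sufficient condition at `(x, λ)`, where `λ = (y, Γ)` is a multiplier at `x`:
`⟨∇²ₓₓL(x, λ) d, d⟩ - Υ_{G(x)}(Γ, ∇G(x) d) > 0` for all nonzero critical directions `d`. -/
def SOSC (f : X → ℝ) (h : X → Y) (G : X → SymMat n) (x : X) (lam : Dual Y n) : Prop :=
  ∀ d ∈ programCriticalCone h G x lam.snd, d ≠ 0 →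
    0 < fderiv ℝ (fderiv ℝ (fun x' => lagrangian f h G x' lam)) x d d
      - sigmaTerm (G x) lam.snd (fderiv ℝ G x d)

end Program

end NLSDP

namespace NLSDP

/-! Write Φ = (h, G) and 𝒦 = {0} × 𝒮ⁿ₊. Completing the square (`augLagrangian_term_eq`) turns ℒ(x,
λ, ρ) into the infimum over z ∈ 𝒦 of L(x, λ) - ⟨λ, z⟩ + (ρ/2)‖Φ(x) - z‖². A multiplier is
nonpositive on 𝒦 and vanishes at Φ(x̄), so ℒ lies between L and L + (ρ/2)‖Φ(x) - Φ(x̄)‖². Hence ℒ(·,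
λ, ρ) has zero derivative at x̄, and its second semiderivative is a plain liminf of second order
quotients. Neither the projection onto 𝒮ⁿ₊ nor a formula for the derivatives of dist² is needed.

(b) ⇒ (a): in a critical direction d, `exists_second_order_lift` supplies a curve in 𝒦 tangent to
Φ'(x̄)d whose second order term S satisfies 2⟨Γ, S⟩ = Υ. Inserting it as z bounds the second
semiderivative by the SOSC form (`secondSemideriv_augLagrangian_le`).

(a) ⇒ (b): if (b) fails, there are λₖ → λ̄, ρₖ → ∞, steps sₖ → 0, unit vectors uₖ → u₀ and points zₖ
∈ 𝒦 with vanishing quadratic growth. The penalty forces (zₖ - Φ(x̄))/sₖ → Φ'(x̄)u₀, which makes u₀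
critical. The inequality `trace_lower_bound_of_perturbation` keeps the lower limit of -⟨λₖ, zₖ⟩/sₖ²
at least -Υ/2, so the SOSC form at u₀ is at most 0 (`SOSC.not_vanishing_growth`). -/

theorem SymMat.inner_eq_trace {n : ℕ} (A B : SymMat n) :
    inner ℝ A B = (A.mat * B.mat).trace := by
  change (A.matᵀ * B.mat).trace = _
  rw [A.isSymm.eq]

/-- The underlying matrix as a linear map. -/
def SymMat.matLinear (n : ℕ) : SymMat n →ₗ[ℝ] Matrix (Fin n) (Fin n) ℝ where
  toFun := SymMat.mat
  map_add' _ _ := rfl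
  map_smul' _ _ := rfl

theorem SymMat.mat_add {n : ℕ} (A B : SymMat n) : (A + B).mat = A.mat + B.mat := rfl

theorem SymMat.mat_smul {n : ℕ} (c : ℝ) (A : SymMat n) : (c • A).mat = c • A.mat := rfl

theorem SymMat.continuous_mat {n : ℕ} :
    Continuous (SymMat.mat : SymMat n → Matrix (Fin n) (Fin n) ℝ) :=
  (SymMat.matLinear n).continuous_of_finiteDimensional

/-! ### Positive semidefinite matrices, the pseudoinverse and the second order geometry of the cone.
-/

section Matrices

variable {n : ℕ}

open scoped MatrixOrder in
theorem _root_.Matrix.PosSemidef.exists_eq_transpose_mul_self {A : Matrix (Fin n) (Fin n) ℝ}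
    (hA : A.PosSemidef) : ∃ B : Matrix (Fin n) (Fin n) ℝ, A = Bᵀ * B := by
  obtain ⟨B, hB⟩ := CStarAlgebra.nonneg_iff_eq_star_mul_self.1 hA.nonneg
  exact ⟨B, by rwa [Matrix.star_eq_conjTranspose,
    Matrix.conjTranspose_eq_transpose_of_trivial] at hB⟩

theorem _root_.Matrix.PosSemidef.transpose_mul_mul {A : Matrix (Fin n) (Fin n) ℝ}
    (hA : A.PosSemidef) (B : Matrix (Fin n) (Fin n) ℝ) : (Bᵀ * A * B).PosSemidef := by
  have h := hA.conjTranspose_mul_mul_same B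
  rwa [Matrix.conjTranspose_eq_transpose_of_trivial] at h

theorem _root_.Matrix.PosSemidef.trace_mul_nonneg {A B : Matrix (Fin n) (Fin n) ℝ}
    (hA : A.PosSemidef) (hB : B.PosSemidef) : 0 ≤ (A * B).trace := by
  obtain ⟨C, rfl⟩ := hA.exists_eq_transpose_mul_self
  have h := (hB.transpose_mul_mul Cᵀ).trace_nonneg
  rwa [Matrix.transpose_transpose, Matrix.trace_mul_comm, ← Matrix.mul_assoc] at h

/-- With A = CᵀC and B = DᵀD, the trace of AB is the squared Frobenius norm of DCᵀ. -/
theorem _root_.Matrix.PosSemidef.mul_eq_zero_of_trace_mul_eq_zero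
    {A B : Matrix (Fin n) (Fin n) ℝ}
    (hA : A.PosSemidef) (hB : B.PosSemidef) (h : (A * B).trace = 0) : A * B = 0 := by
  obtain ⟨C, rfl⟩ := hA.exists_eq_transpose_mul_self
  obtain ⟨D, rfl⟩ := hB.exists_eq_transpose_mul_self
  have h1 : ((D * Cᵀ)ᴴ * (D * Cᵀ)).trace = 0 := by
    rw [Matrix.conjTranspose_eq_transpose_of_trivial, Matrix.transpose_mul,
      Matrix.transpose_transpose, ← h, Matrix.trace_mul_comm]
    rw [show D * Cᵀ * (C * Dᵀ) = D * (Cᵀ * C * Dᵀ) by simp only [Matrix.mul_assoc],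
      Matrix.trace_mul_comm]
    simp only [Matrix.mul_assoc]
  have h2 : D * Cᵀ = 0 := Matrix.trace_conjTranspose_mul_self_eq_zero_iff.1 h1
  have h3 : C * Dᵀ = 0 := by
    rw [← Matrix.transpose_transpose C, ← Matrix.transpose_mul, h2, Matrix.transpose_zero]
  rw [Matrix.mul_assoc, ← Matrix.mul_assoc C, h3, Matrix.zero_mul, Matrix.mul_zero]

theorem spectral_decomposition (A : SymMat n) :
    A.mat = (A.isHermitian.eigenvectorUnitary : Matrix (Fin n) (Fin n) ℝ) *
      Matrix.diagonal A.isHermitian.eigenvalues *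
      (A.isHermitian.eigenvectorUnitary : Matrix (Fin n) (Fin n) ℝ)ᵀ := by
  have h := A.isHermitian.spectral_theorem
  rwa [Unitary.conjStarAlgAut_apply] at h

theorem eigenvectorUnitary_transpose_mul (A : SymMat n) :
    (A.isHermitian.eigenvectorUnitary : Matrix (Fin n) (Fin n) ℝ)ᵀ *
      (A.isHermitian.eigenvectorUnitary : Matrix (Fin n) (Fin n) ℝ) = 1 :=
  Unitary.coe_star_mul_self A.isHermitian.eigenvectorUnitary

theorem conj_diagonal_mul {U : Matrix (Fin n) (Fin n) ℝ} (hU : Uᵀ * U = 1) (a b : Fin n → ℝ) :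
    (U * Matrix.diagonal a * Uᵀ) * (U * Matrix.diagonal b * Uᵀ) =
      U * Matrix.diagonal (fun i => a i * b i) * Uᵀ := by
  rw [← Matrix.diagonal_mul_diagonal]
  simp only [Matrix.mul_assoc]
  rw [← Matrix.mul_assoc Uᵀ U, hU, Matrix.one_mul]

theorem pinv_transpose (A : SymMat n) : (pinv A)ᵀ = pinv A := by
  simp only [pinv, Matrix.transpose_mul, Matrix.transpose_transpose, Matrix.diagonal_transpose,
    Matrix.mul_assoc]

theorem mul_pinv_comm (A : SymMat n) : A.mat * pinv A = pinv A * A.mat := by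
  conv_lhs => rw [spectral_decomposition A]
  conv_rhs => rw [spectral_decomposition A]
  simp only [pinv, conj_diagonal_mul (eigenvectorUnitary_transpose_mul A), mul_comm]

theorem mul_pinv_mul (A : SymMat n) : A.mat * pinv A * A.mat = A.mat := by
  have hA := spectral_decomposition A
  conv_rhs => rw [hA]
  conv_lhs => rw [hA]
  simp only [pinv, conj_diagonal_mul (eigenvectorUnitary_transpose_mul A), mul_inv_mul_cancel]

theorem pinv_mul_pinv (A : SymMat n) : pinv A * A.mat * pinv A = pinv A := by
  conv_lhs => rw [spectral_decomposition A]
  simp only [pinv, conj_diagonal_mul (eigenvectorUnitary_transpose_mul A),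
    show ∀ a : ℝ, a⁻¹ * a * a⁻¹ = a⁻¹ from fun a => by simpa using mul_inv_mul_cancel a⁻¹]

/-- Expand 0 ≤ tr(N (1 - V)ᵀ Z (1 - V)). The free matrix V is what makes the bound sharp to second
order. -/
theorem posSemidef_trace_lower_bound {N Z : Matrix (Fin n) (Fin n) ℝ} (hN : N.PosSemidef)
    (hZ : Z.PosSemidef) (V : Matrix (Fin n) (Fin n) ℝ) :
    2 * (N * Z * V).trace - (N * Vᵀ * Z * V).trace ≤ (N * Z).trace := by
  have h := hN.trace_mul_nonneg (hZ.transpose_mul_mul (1 - V))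
  have hN' : Nᵀ = N := by simpa using hN.isHermitian.eq
  have hZ' : Zᵀ = Z := by simpa using hZ.isHermitian.eq
  have h1 : (N * (Vᵀ * Z)).trace = (N * Z * V).trace := by
    rw [← Matrix.trace_transpose (N * (Vᵀ * Z)), Matrix.transpose_mul, Matrix.transpose_mul,
      Matrix.transpose_transpose, hN', hZ', Matrix.trace_mul_comm, Matrix.mul_assoc]
  have h2 : N * ((1 - V)ᵀ * Z * (1 - V)) =
      N * Z - N * Z * V - N * (Vᵀ * Z) + N * Vᵀ * Z * V := by
    rw [Matrix.transpose_sub, Matrix.transpose_one]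
    noncomm_ring
  rw [h2, Matrix.trace_add, Matrix.trace_sub, Matrix.trace_sub, h1] at h
  linarith

/-- Take V = t A†D above: NA = 0 removes the lower order terms and A†AA† = A† produces D A† D. As E
→ D and t → 0, the bracket tends to tr(N D A† D). Only first order convergence of E is required, so
nothing need be known about the curvature of a sequence in the cone. -/
theorem trace_lower_bound_of_perturbation (A E D : SymMat n) {N : Matrix (Fin n) (Fin n) ℝ}
    (hN : N.PosSemidef) (hNA : N * A.mat = 0) {t : ℝ} (hZ : (A + t • E).mat.PosSemidef) :
    t ^ 2 * (2 * (N * E.mat * (pinv A * D.mat)).trace - (N * (D.mat * pinv A * D.mat)).trace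
      - t * (N * (D.mat * pinv A) * E.mat * (pinv A * D.mat)).trace) ≤
      (N * (A + t • E).mat).trace := by
  refine le_trans (le_of_eq ?_) (posSemidef_trace_lower_bound hN hZ (t • (pinv A * D.mat)))
  have h1 : N * (A + t • E).mat * (t • (pinv A * D.mat)) =
      t ^ 2 • (N * E.mat * (pinv A * D.mat)) := by
    rw [SymMat.mat_add, SymMat.mat_smul, Matrix.mul_add, hNA, zero_add]
    simp only [Matrix.mul_smul, Matrix.smul_mul, smul_smul, sq]
  have h2 : N * (t • (pinv A * D.mat))ᵀ * (A + t • E).mat * (t • (pinv A * D.mat)) =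
      t ^ 2 • (N * (D.mat * pinv A * D.mat)) +
      t ^ 3 • (N * (D.mat * pinv A) * E.mat * (pinv A * D.mat)) := by
    have h3 : N * (D.mat * pinv A * D.mat) =
        N * (D.mat * pinv A) * A.mat * (pinv A * D.mat) := by
      conv_lhs => rw [← pinv_mul_pinv A]
      simp only [Matrix.mul_assoc]
    rw [h3, SymMat.mat_add, SymMat.mat_smul, Matrix.transpose_smul, Matrix.transpose_mul,
      D.isSymm.eq, pinv_transpose]
    simp only [Matrix.mul_add, Matrix.add_mul, Matrix.mul_smul, Matrix.smul_mul, smul_smul,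
      smul_add]
    congr 2 <;> ring
  rw [h1, h2, Matrix.trace_add]
  simp only [Matrix.trace_smul, smul_eq_mul]
  ring

theorem dotProduct_nonneg_of_mem_tangentCone {A D : SymMat n}
    (hD : D ∈ tangentCone (psdCone n) A) {x : Fin n → ℝ} (hx : A.mat *ᵥ x = 0) :
    0 ≤ x ⬝ᵥ (D.mat *ᵥ x) := by
  obtain ⟨t, v, ht, -, hv, hmem⟩ := hD
  have hc : Continuous fun B : SymMat n => x ⬝ᵥ (B.mat *ᵥ x) :=
    continuous_const.dotProduct (SymMat.continuous_mat.matrix_mulVec continuous_const)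
  refine ge_of_tendsto' ((hc.tendsto D).comp hv) fun k => ?_
  have h := (hmem k : (A + t k • v k).mat.PosSemidef).dotProduct_mulVec_nonneg x
  rw [SymMat.mat_add, SymMat.mat_smul, Matrix.add_mulVec, hx, zero_add, Matrix.smul_mulVec,
    dotProduct_smul, smul_eq_mul, star_trivial] at h
  exact (mul_nonneg_iff_of_pos_left (ht k)).1 h

/-- A second order lift of a tangent direction into the cone of positive semidefinite matrices. -/
theorem exists_second_order_lift {A D : SymMat n} (hA : A ∈ psdCone n)
    (hD : D ∈ tangentCone (psdCone n) A) {Γ : Matrix (Fin n) (Fin n) ℝ} (hΓ : Γᵀ = Γ)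
    (hΓA : Γ * A.mat = 0) :
    ∃ S : SymMat n, (Γ * S.mat).trace = (Γ * (D.mat * pinv A * D.mat)).trace ∧
      ∀ t : ℝ, 0 ≤ t → A + t • D + t ^ 2 • S ∈ psdCone n := by
  have hBt := pinv_transpose A
  have hAt : A.matᵀ = A.mat := A.isSymm.eq
  have hDt : D.matᵀ = D.mat := D.isSymm.eq
  have hBA := (mul_pinv_comm A).symm
  have hAPA := mul_pinv_mul A
  have hBAB := pinv_mul_pinv A
  obtain ⟨B, hB⟩ : ∃ B, B = pinv A := ⟨_, rfl⟩
  rw [← hB] at hBt hBA hAPA hBAB ⊢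
  -- P is the orthogonal projection onto the range of A.
  obtain ⟨P, hP⟩ : ∃ P, P = A.mat * B := ⟨_, rfl⟩
  rw [← hP] at hBA hAPA
  have hPt : Pᵀ = P := by rw [hP, Matrix.transpose_mul, hAt, hBt, hBA, hP]
  have hΓP : Γ * P = 0 := by rw [hP, ← Matrix.mul_assoc, hΓA, Matrix.zero_mul]
  have hAP : A.mat * P = A.mat := by rw [← hBA, ← Matrix.mul_assoc]; rw [← hP, hAPA]
  -- W is chosen so that AW + WᵀA = PD + DP - PDP, which is D without its kernel block; the factor
  -- 1/2 avoids counting the block PDP twice. With S = WᵀAW the curve then equals (1 + tW)ᵀA(1 + tW)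
  -- + t(1 - P)D(1 - P), with no remainder.
  obtain ⟨W, hW⟩ : ∃ W, W = B * D.mat - (1 / 2 : ℝ) • (B * D.mat * P) := ⟨_, rfl⟩
  have hWt : Wᵀ = D.mat * B - (1 / 2 : ℝ) • (P * D.mat * B) := by
    rw [hW, Matrix.transpose_sub, Matrix.transpose_smul, Matrix.transpose_mul,
      Matrix.transpose_mul, Matrix.transpose_mul, hBt, hDt, hPt, Matrix.mul_assoc P]
  have hAW : A.mat * W = P * D.mat - (1 / 2 : ℝ) • (P * D.mat * P) := by
    rw [hW, Matrix.mul_sub, Matrix.mul_smul, ← Matrix.mul_assoc, ← Matrix.mul_assoc,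
      ← Matrix.mul_assoc, ← hP]
  have hWA : Wᵀ * A.mat = D.mat * P - (1 / 2 : ℝ) • (P * D.mat * P) := by
    rw [hWt, Matrix.sub_mul, Matrix.smul_mul, Matrix.mul_assoc, Matrix.mul_assoc _ B, hBA]
  have hSsymm : (Wᵀ * A.mat * W).IsSymm := by
    rw [Matrix.IsSymm, Matrix.transpose_mul, Matrix.transpose_mul, Matrix.transpose_transpose,
      hAt, Matrix.mul_assoc]
  let S : SymMat n := ⟨Wᵀ * A.mat * W, hSsymm⟩
  refine ⟨S, ?_, fun t ht => ?_⟩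
  · change (Γ * (Wᵀ * A.mat * W)).trace = _
    have h1 : Γ * (Wᵀ * A.mat * W) =
        Γ * (D.mat * B * D.mat) - (1 / 2 : ℝ) • (Γ * (D.mat * B * D.mat) * P) := by
      rw [hWA, Matrix.sub_mul, Matrix.mul_sub, Matrix.smul_mul, Matrix.mul_smul,
        show Γ * (P * D.mat * P * W) = Γ * P * (D.mat * P * W) by simp only [Matrix.mul_assoc],
        hΓP, Matrix.zero_mul, smul_zero, sub_zero, hW]
      have hPB : P * B = B := by rw [← hBA]; exact hBAB
      simp only [Matrix.mul_sub, Matrix.mul_smul, Matrix.mul_assoc]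
      rw [← Matrix.mul_assoc P B, ← Matrix.mul_assoc P B, hPB]
    have hPΓ : P * Γ = 0 := by
      rw [← hPt, ← hΓ, ← Matrix.transpose_mul, hΓP, Matrix.transpose_zero]
    rw [h1, Matrix.trace_sub, Matrix.trace_smul, Matrix.trace_mul_comm _ P, ← Matrix.mul_assoc P,
      hPΓ, Matrix.zero_mul, Matrix.trace_zero, smul_zero, sub_zero]
  -- Tangency of D enters only here: 1 - P maps into the kernel of A, where D is nonnegative.
  · have hQ : ((1 - P)ᵀ * D.mat * (1 - P)).PosSemidef := by
      refine Matrix.PosSemidef.of_dotProduct_mulVec_nonneg ?_ fun x => ?_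
      · rw [Matrix.IsHermitian, Matrix.conjTranspose_eq_transpose_of_trivial,
          Matrix.transpose_mul, Matrix.transpose_mul, Matrix.transpose_transpose, hDt,
          Matrix.mul_assoc]
      · have hx : A.mat *ᵥ ((1 - P) *ᵥ x) = 0 := by
          rw [Matrix.mulVec_mulVec, Matrix.mul_sub, Matrix.mul_one, hAP, sub_self,
            Matrix.zero_mulVec]
        have h := dotProduct_nonneg_of_mem_tangentCone hD hx
        rw [star_trivial, Matrix.mul_assoc, ← Matrix.mulVec_mulVec, Matrix.dotProduct_mulVec,
          Matrix.vecMul_transpose, ← Matrix.mulVec_mulVec]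
        exact h
    have h1 : (A + t • D + t ^ 2 • S).mat =
        (1 + t • W)ᵀ * A.mat * (1 + t • W) + t • ((1 - P)ᵀ * D.mat * (1 - P)) := by
      change A.mat + t • D.mat + t ^ 2 • (Wᵀ * A.mat * W) = _
      have h2 : (1 + t • W)ᵀ * A.mat * (1 + t • W) =
          A.mat + t • (A.mat * W) + t • (Wᵀ * A.mat) + t ^ 2 • (Wᵀ * A.mat * W) := by
        rw [Matrix.transpose_add, Matrix.transpose_one, Matrix.transpose_smul]
        simp only [Matrix.add_mul, Matrix.mul_add, Matrix.one_mul, Matrix.mul_one,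
          Matrix.smul_mul, Matrix.mul_smul, smul_smul, smul_add, sq]
        abel
      have h3 : (1 - P)ᵀ * D.mat * (1 - P) =
          D.mat - P * D.mat - D.mat * P + P * D.mat * P := by
        rw [Matrix.transpose_sub, Matrix.transpose_one, hPt]
        noncomm_ring
      rw [h2, h3, hAW, hWA]
      module
    change (A + t • D + t ^ 2 • S).mat.PosSemidef
    rw [h1]
    exact ((hA : A.mat.PosSemidef).transpose_mul_mul _).add (hQ.smul ht)

end Matrices

/-! ### First and second order difference quotients along moving directions. -/

section Calculus

variable {E F : Type*} [NormedAddCommGroup E] [NormedSpace ℝ E]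
  [NormedAddCommGroup F] [NormedSpace ℝ F]

/-- The second order Taylor expansion of a twice continuously differentiable mapping. -/
theorem _root_.ContDiff.taylor_two_isLittleO {g : E → F} (hg : ContDiff ℝ 2 g) (x : E) :
    (fun v => g (x + v) - g x - fderiv ℝ g x v - (1 / 2 : ℝ) • fderiv ℝ (fderiv ℝ g) x v v)
      =o[𝓝 0] fun v => ‖v‖ ^ 2 := by
  have hg1 : Differentiable ℝ g := hg.differentiable (by norm_num)
  have hg2 : Differentiable ℝ (fderiv ℝ g) :=
    (hg.fderiv_right (m := 1) (by norm_num)).differentiable (by norm_num)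
  have hsymm : IsSymmSndFDerivAt ℝ g x := hg.contDiffAt.isSymmSndFDerivAt (by simp)
  -- By symmetry of the second derivative, the derivative of the remainder is the first order
  -- remainder of `fderiv ℝ g`, which is o(‖v‖); integrating gains one order.
  have hder : ∀ v ∈ (Set.univ : Set E), HasFDerivWithinAt
      (fun v => g (x + v) - g x - fderiv ℝ g x v -
        (1 / 2 : ℝ) • fderiv ℝ (fderiv ℝ g) x v v)
      (fderiv ℝ g (x + v) - fderiv ℝ g x - fderiv ℝ (fderiv ℝ g) x v) Set.univ v := by
    intro v _
    rw [hasFDerivWithinAt_univ]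
    have h1 : HasFDerivAt (fun v => g (x + v)) (fderiv ℝ g (x + v)) v :=
      (hasFDerivAt_comp_add_left (f := g) x).2 (hg1 (x + v)).hasFDerivAt
    have h2 : HasFDerivAt (fun v => fderiv ℝ (fderiv ℝ g) x v v)
        ((fderiv ℝ (fderiv ℝ g) x v).comp (ContinuousLinearMap.id ℝ E) +
          (fderiv ℝ (fderiv ℝ g) x).flip v) v :=
      (fderiv ℝ (fderiv ℝ g) x).hasFDerivAt.clm_apply (hasFDerivAt_id v)
    convert! ((h1.sub_const (g x)).sub (fderiv ℝ g x).hasFDerivAt).sub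
      (h2.const_smul (1 / 2 : ℝ)) using 1
    ext w
    have h3 := hsymm.eq w v
    simp only [_root_.sub_apply, _root_.smul_apply,
      _root_.add_apply, ContinuousLinearMap.comp_apply,
      ContinuousLinearMap.id_apply, ContinuousLinearMap.flip_apply, h3]
    module
  have hlittle : (fun v => fderiv ℝ g (x + v) - fderiv ℝ g x - fderiv ℝ (fderiv ℝ g) x v)
      =o[𝓝[Set.univ] 0] fun v : E => ‖v - 0‖ ^ 1 := by
    simp only [nhdsWithin_univ, sub_zero, pow_one]
    exact (hasFDerivAt_iff_isLittleO_nhds_zero.1 (hg2 x).hasFDerivAt).norm_right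
  have h := convex_univ.isLittleO_pow_succ (Set.mem_univ (0 : E)) hder hlittle
  simpa using h

variable {ι : Type*} {l : Filter ι} {s : ι → ℝ} {u : ι → E} {u₀ : E}

theorem _root_.HasFDerivAt.tendsto_inv_smul {g : E → F} {g' : E →L[ℝ] F} {x : E}
    (hg : HasFDerivAt g g' x)
    (hs : Tendsto s l (𝓝[>] 0)) (hu : Tendsto u l (𝓝 u₀)) :
    Tendsto (fun k => (s k)⁻¹ • (g (x + s k • u k) - g x)) l (𝓝 (g' u₀)) := by
  have hs0 : Tendsto s l (𝓝 0) := hs.mono_right nhdsWithin_le_nhds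
  refine hg.hasFDerivWithinAt.lim (s := Set.univ) (by simpa using hs0.smul hu) (by simp) ?_
  refine hu.congr' ?_
  filter_upwards [hs self_mem_nhdsWithin] with k hk
  rw [smul_smul, inv_mul_cancel₀ (ne_of_gt hk), one_smul]

theorem _root_.ContDiff.tendsto_second_order_quotient {g : E → F} (hg : ContDiff ℝ 2 g) (x : E)
    (hs : Tendsto s l (𝓝[>] 0)) (hu : Tendsto u l (𝓝 u₀)) :
    Tendsto (fun k => (s k ^ 2)⁻¹ • (g (x + s k • u k) - g x - s k • fderiv ℝ g x (u k))) l
      (𝓝 ((1 / 2 : ℝ) • fderiv ℝ (fderiv ℝ g) x u₀ u₀)) := by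
  have hs0 : Tendsto s l (𝓝 0) := hs.mono_right nhdsWithin_le_nhds
  have hv : Tendsto (fun k => s k • u k) l (𝓝 0) := by simpa using hs0.smul hu
  have h1 := (hg.taylor_two_isLittleO x).comp_tendsto hv
  have h2 : ((fun v : E => ‖v‖ ^ 2) ∘ fun k => s k • u k) =O[l] fun k => s k ^ 2 := by
    have h3 : (fun k => s k • u k) =O[l] fun k => s k := by
      simpa using (Asymptotics.isBigO_refl s l).smul (hu.isBigO_one ℝ)
    exact h3.norm_left.pow 2
  have h4 := (h1.trans_isBigO h2).tendsto_inv_smul_nhds_zero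
  have h5 : Tendsto (fun k => (1 / 2 : ℝ) • fderiv ℝ (fderiv ℝ g) x (u k) (u k)) l
      (𝓝 ((1 / 2 : ℝ) • fderiv ℝ (fderiv ℝ g) x u₀ u₀)) :=
    (((fderiv ℝ (fderiv ℝ g) x).continuous₂.tendsto (u₀, u₀)).comp (hu.prodMk_nhds hu)).const_smul _
  have h6 := h4.add h5
  rw [zero_add] at h6
  refine h6.congr' ?_
  filter_upwards [hs self_mem_nhdsWithin] with k hk
  have hk0 : s k ≠ 0 := ne_of_gt hk
  simp only [Function.comp_apply, map_smul, _root_.smul_apply]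
  rw [smul_sub _ _ ((1 / 2 : ℝ) • _), smul_smul, smul_smul, smul_smul,
    show (s k ^ 2)⁻¹ * (1 / 2) * s k * s k = 1 / 2 by field_simp, sub_add_cancel]

end Calculus

/-! ### The second semiderivative at a point of zero derivative. -/

section SecondSemiderivative

variable {E : Type*} [NormedAddCommGroup E] [InnerProductSpace ℝ E] {φ : E → ℝ} {x : E}

theorem subderiv_eq_zero (hφ : HasFDerivAt φ (0 : E →L[ℝ] ℝ) x) (w : E) :
    subderiv φ x w = 0 := by
  have h := hφ.tendsto_inv_smul (l := 𝓝[>] (0 : ℝ) ×ˢ 𝓝 w) tendsto_fst tendsto_snd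
  have h' : Tendsto (fun p : ℝ × E => (((φ (x + p.1 • p.2) - φ x) / p.1 : ℝ) : EReal))
      (𝓝[>] 0 ×ˢ 𝓝 w) (𝓝 ((0 : ℝ) : EReal)) := by
    refine (continuous_coe_real_ereal.tendsto 0).comp ?_
    simpa [div_eq_inv_mul] using h
  exact h'.liminf_eq

theorem secondSemideriv_eq_liminf (hφ : HasFDerivAt φ (0 : E →L[ℝ] ℝ) x) (w : E) :
    secondSemideriv φ x w =
      liminf (fun p : ℝ × E => (((φ (x + p.1 • p.2) - φ x) / (p.1 ^ 2 / 2) : ℝ) : EReal))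
        (𝓝[>] 0 ×ˢ 𝓝 w) := by
  simp only [secondSemideriv, subderiv_eq_zero hφ, mul_zero, sub_zero, EReal.coe_div]

theorem secondSemideriv_le_of_tendsto (hφ : HasFDerivAt φ (0 : E →L[ℝ] ℝ) x) {w : E}
    {b : ℝ → ℝ} {c : ℝ} (hb : Tendsto b (𝓝[>] 0) (𝓝 c))
    (hle : ∀ t > 0, (φ (x + t • w) - φ x) / (t ^ 2 / 2) ≤ b t) :
    secondSemideriv φ x w ≤ (c : EReal) := by
  rw [secondSemideriv_eq_liminf hφ]
  have hmap : Tendsto (fun t : ℝ => (t, w)) (𝓝[>] 0) (𝓝[>] 0 ×ˢ 𝓝 w) :=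
    tendsto_id.prodMk tendsto_const_nhds
  -- Freezing w' = w restricts the filter, which can only raise the liminf.
  refine (liminf_le_liminf_of_le hmap).trans ?_
  have hb' : Tendsto (fun t => (b t : EReal)) (𝓝[>] 0) (𝓝 (c : EReal)) :=
    (continuous_coe_real_ereal.tendsto c).comp hb
  rw [← hb'.liminf_eq]
  change liminf (fun t : ℝ => (((φ (x + t • w) - φ x) / (t ^ 2 / 2) : ℝ) : EReal)) (𝓝[>] 0) ≤ _
  refine liminf_le_liminf ?_
  filter_upwards [self_mem_nhdsWithin] with t ht
  exact EReal.coe_le_coe_iff.2 (hle t ht)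

/-- A direction w' near w realises the small quotient and is rescaled to unit length. From ‖w‖ ≤
2‖w'‖ one gets (t²/2)c‖w‖² ≤ 2c(t‖w'‖)², hence the constant 2c. -/
theorem exists_small_step_of_secondSemideriv_lt (hφ : HasFDerivAt φ (0 : E →L[ℝ] ℝ) x) {w : E}
    (hw : w ≠ 0) {c δ : ℝ} (hc : 0 < c) (hδ : 0 < δ)
    (hlt : secondSemideriv φ x w < ((c * ‖w‖ ^ 2 : ℝ) : EReal)) :
    ∃ (s : ℝ) (u : E), 0 < s ∧ s < δ ∧ ‖u‖ = 1 ∧ φ (x + s • u) - φ x < 2 * c * s ^ 2 := by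
  rw [secondSemideriv_eq_liminf hφ] at hlt
  have hfreq := frequently_lt_of_liminf_lt (by isBoundedDefault) hlt
  have hpos : ∀ᶠ p : ℝ × E in 𝓝[>] 0 ×ˢ 𝓝 w, 0 < p.1 :=
    tendsto_fst.eventually self_mem_nhdsWithin
  have hlow : ∀ᶠ p : ℝ × E in 𝓝[>] 0 ×ˢ 𝓝 w, ‖w‖ / 2 < ‖p.2‖ :=
    (tendsto_snd.norm).eventually (lt_mem_nhds (half_lt_self (norm_pos_iff.2 hw)))
  have hsmall : ∀ᶠ p : ℝ × E in 𝓝[>] 0 ×ˢ 𝓝 w, p.1 * ‖p.2‖ < δ := by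
    have h : Tendsto (fun p : ℝ × E => p.1 * ‖p.2‖) (𝓝[>] 0 ×ˢ 𝓝 w) (𝓝 (0 * ‖w‖)) :=
      (tendsto_fst.mono_right nhdsWithin_le_nhds).mul tendsto_snd.norm
    rw [zero_mul] at h
    exact h.eventually (gt_mem_nhds hδ)
  obtain ⟨⟨t, w'⟩, hp, ht, hl, hd⟩ := (hfreq.and_eventually (hpos.and (hlow.and hsmall))).exists
  simp only at hp ht hl hd
  have hw' : 0 < ‖w'‖ := (by positivity : 0 ≤ ‖w‖ / 2).trans_lt hl
  refine ⟨t * ‖w'‖, ‖w'‖⁻¹ • w', mul_pos ht hw', hd, ?_, ?_⟩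
  · rw [norm_smul, norm_inv, norm_norm, inv_mul_cancel₀ hw'.ne']
  · rw [smul_smul, mul_assoc, mul_inv_cancel₀ hw'.ne', mul_one]
    rw [EReal.coe_lt_coe_iff, div_lt_iff₀ (by positivity)] at hp
    have h1 : ‖w‖ ^ 2 ≤ 4 * ‖w'‖ ^ 2 := by
      nlinarith [norm_nonneg w]
    have h2 : c * t ^ 2 * ‖w‖ ^ 2 ≤ c * t ^ 2 * (4 * ‖w'‖ ^ 2) :=
      mul_le_mul_of_nonneg_left h1 (by positivity)
    calc _ < _ := hp
      _ ≤ _ := by linarith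

end SecondSemiderivative

/-! ### The augmented Lagrangian as an infimum over the constraint cone. -/

theorem augLagrangian_term_eq {V : Type*} [NormedAddCommGroup V] [InnerProductSpace ℝ V]
    (a z l : V) {ρ : ℝ} (hρ : 0 < ρ) :
    ρ / 2 * ‖a + ρ⁻¹ • l - z‖ ^ 2 - ‖l‖ ^ 2 / (2 * ρ) =
      inner ℝ l a - inner ℝ l z + ρ / 2 * ‖a - z‖ ^ 2 := by
  rw [show a + ρ⁻¹ • l - z = (a - z) + ρ⁻¹ • l by abel, norm_add_sq_real, inner_smul_right,
    norm_smul, real_inner_comm, inner_sub_right, Real.norm_eq_abs, abs_of_pos (inv_pos.2 hρ)]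
  field_simp
  ring

theorem zero_mem_constraintCone {Y : Type*} [NormedAddCommGroup Y] {n : ℕ} :
    (0 : Dual Y n) ∈ constraintCone Y n :=
  ⟨rfl, Matrix.PosSemidef.zero⟩

section Infimum

variable {X Y : Type*} [NormedAddCommGroup Y] [InnerProductSpace ℝ Y] {n : ℕ}
  {f : X → ℝ} {h : X → Y} {G : X → SymMat n} {lam : Dual Y n}

theorem lagrangian_eq_inner (x : X) (lam : Dual Y n) :
    lagrangian f h G x lam = f x + inner ℝ lam (constraintMap h G x) := by
  rw [lagrangian, WithLp.prod_inner_apply, ← add_assoc]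
  rfl

theorem augLagrangian_le {ρ : ℝ} (hρ : 0 < ρ) (x : X) {z : Dual Y n}
    (hz : z ∈ constraintCone Y n) :
    augLagrangian f h G x lam ρ ≤
      lagrangian f h G x lam - inner ℝ lam z + ρ / 2 * ‖constraintMap h G x - z‖ ^ 2 := by
  have h1 := Metric.infDist_le_dist_of_mem (x := constraintMap h G x + ρ⁻¹ • lam) hz
  rw [dist_eq_norm] at h1
  have h2 := augLagrangian_term_eq (constraintMap h G x) z lam hρ
  have h3 : ρ / 2 * Metric.infDist (constraintMap h G x + ρ⁻¹ • lam) (constraintCone Y n) ^ 2 ≤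
      ρ / 2 * ‖constraintMap h G x + ρ⁻¹ • lam - z‖ ^ 2 := by
    have := Metric.infDist_nonneg (x := constraintMap h G x + ρ⁻¹ • lam)
      (s := constraintCone Y n)
    gcongr
  rw [augLagrangian, lagrangian_eq_inner]
  linarith

theorem exists_lt_of_augLagrangian_lt {ρ : ℝ} (hρ : 0 < ρ) {x : X} {c : ℝ}
    (hc : augLagrangian f h G x lam ρ < c) :
    ∃ z ∈ constraintCone Y n,
      lagrangian f h G x lam - inner ℝ lam z + ρ / 2 * ‖constraintMap h G x - z‖ ^ 2 < c := by
  rw [augLagrangian] at hc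
  have h1 : Metric.infDist (constraintMap h G x + ρ⁻¹ • lam) (constraintCone Y n) ^ 2 <
      (c - f x + ‖lam‖ ^ 2 / (2 * ρ)) / (ρ / 2) := by
    rw [lt_div_iff₀ (by positivity)]
    linarith
  obtain ⟨z, hz, hdist⟩ := (Metric.infDist_lt_iff ⟨0, zero_mem_constraintCone⟩).1
    (Real.lt_sqrt_of_sq_lt h1)
  refine ⟨z, hz, ?_⟩
  rw [dist_eq_norm, Real.lt_sqrt (norm_nonneg _), lt_div_iff₀ (by positivity)] at hdist
  have h2 := augLagrangian_term_eq (constraintMap h G x) z lam hρ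
  rw [lagrangian_eq_inner]
  linarith


end Infimum

/-! ### Consequences of the KKT conditions and first order behaviour of the augmented Lagrangian. -/

section Program

variable {X Y : Type*} [NormedAddCommGroup X] [InnerProductSpace ℝ X]
  [NormedAddCommGroup Y] [InnerProductSpace ℝ Y] {n : ℕ}
  {f : X → ℝ} {h : X → Y} {G : X → SymMat n} {xbar : X} {lam : Dual Y n}

theorem contDiff_constraintMap (hh : ContDiff ℝ 2 h) (hG : ContDiff ℝ 2 G) :
    ContDiff ℝ 2 (constraintMap h G) :=
  (WithLp.prodContinuousLinearEquiv 2 ℝ Y (SymMat n)).symm.contDiff.comp (hh.prodMk hG)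

theorem fderiv_constraintMap {x : X} (hh : DifferentiableAt ℝ h x)
    (hG : DifferentiableAt ℝ G x) (d : X) :
    fderiv ℝ (constraintMap h G) x d = WithLp.toLp 2 (fderiv ℝ h x d, fderiv ℝ G x d) := by
  have h1 : HasFDerivAt (constraintMap h G)
      ((WithLp.prodContinuousLinearEquiv 2 ℝ Y (SymMat n)).symm.toContinuousLinearMap.comp
        ((fderiv ℝ h x).prod (fderiv ℝ G x))) x :=
    (WithLp.prodContinuousLinearEquiv 2 ℝ Y (SymMat n)).symm.toContinuousLinearMap.hasFDerivAt.comp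
      x (hh.hasFDerivAt.prodMk hG.hasFDerivAt)
  rw [h1.fderiv]
  rfl

theorem contDiff_lagrangian (hf : ContDiff ℝ 2 f) (hh : ContDiff ℝ 2 h) (hG : ContDiff ℝ 2 G)
    (lam : Dual Y n) : ContDiff ℝ 2 fun x => lagrangian f h G x lam := by
  simp only [lagrangian_eq_inner]
  exact hf.add (contDiff_const.inner ℝ (contDiff_constraintMap hh hG))

theorem constraintMap_mem_of_mem_multipliers (hlam : lam ∈ multipliers f h G xbar) :
    constraintMap h G xbar ∈ constraintCone Y n :=
  ⟨hlam.2.1, hlam.2.2.1⟩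

theorem inner_constraintMap_of_mem_multipliers (hlam : lam ∈ multipliers f h G xbar) :
    inner ℝ lam (constraintMap h G xbar) = 0 := by
  have h1 := hlam.2.2.2.1
  rw [real_inner_comm] at h1
  rw [WithLp.prod_inner_apply]
  change inner ℝ lam.fst (h xbar) + inner ℝ lam.snd (G xbar) = 0
  rw [hlam.2.1, h1, inner_zero_right, add_zero]

theorem inner_eq_trace_of_fst_eq_zero {z : Dual Y n} (hz : z.fst = 0) :
    inner ℝ lam z = (lam.snd.mat * z.snd.mat).trace := by
  rw [WithLp.prod_inner_apply]
  change inner ℝ lam.fst z.fst + inner ℝ lam.snd z.snd = _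
  rw [hz, inner_zero_right, zero_add, SymMat.inner_eq_trace]

theorem inner_nonpos_of_mem_multipliers (hlam : lam ∈ multipliers f h G xbar) {z : Dual Y n}
    (hz : z ∈ constraintCone Y n) : inner ℝ lam z ≤ 0 := by
  have h1 := Matrix.PosSemidef.trace_mul_nonneg hlam.2.2.2.2 hz.2
  rw [Matrix.neg_mul, Matrix.trace_neg] at h1
  rw [inner_eq_trace_of_fst_eq_zero hz.1]
  linarith

theorem neg_mul_eq_zero_of_mem_multipliers (hlam : lam ∈ multipliers f h G xbar) :
    (-lam.snd.mat) * (G xbar).mat = 0 := by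
  refine Matrix.PosSemidef.mul_eq_zero_of_trace_mul_eq_zero hlam.2.2.2.2 hlam.2.2.1 ?_
  rw [Matrix.neg_mul, Matrix.trace_neg, ← SymMat.inner_eq_trace, real_inner_comm,
    hlam.2.2.2.1, neg_zero]

theorem lagrangian_le_augLagrangian (hlam : lam ∈ multipliers f h G xbar) {ρ : ℝ} (hρ : 0 < ρ)
    (x : X) : lagrangian f h G x lam ≤ augLagrangian f h G x lam ρ := by
  by_contra! hlt
  obtain ⟨z, hz, hz'⟩ := exists_lt_of_augLagrangian_lt hρ hlt
  have h1 := inner_nonpos_of_mem_multipliers hlam hz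
  have h2 : 0 ≤ ρ / 2 * ‖constraintMap h G x - z‖ ^ 2 := by positivity
  linarith

theorem augLagrangian_le_lagrangian_add (hlam : lam ∈ multipliers f h G xbar) {ρ : ℝ}
    (hρ : 0 < ρ) (x : X) :
    augLagrangian f h G x lam ρ ≤ lagrangian f h G x lam +
      ρ / 2 * ‖constraintMap h G x - constraintMap h G xbar‖ ^ 2 := by
  have h1 := augLagrangian_le (f := f) (h := h) (G := G) (lam := lam) hρ x
    (constraintMap_mem_of_mem_multipliers hlam)
  rwa [inner_constraintMap_of_mem_multipliers hlam, sub_zero] at h1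

theorem augLagrangian_eq_lagrangian (hlam : lam ∈ multipliers f h G xbar) {ρ : ℝ} (hρ : 0 < ρ) :
    augLagrangian f h G xbar lam ρ = lagrangian f h G xbar lam := by
  refine le_antisymm ?_ (lagrangian_le_augLagrangian hlam hρ xbar)
  simpa using augLagrangian_le_lagrangian_add hlam hρ xbar

theorem hasFDerivAt_lagrangian (hf : ContDiff ℝ 2 f) (hh : ContDiff ℝ 2 h) (hG : ContDiff ℝ 2 G)
    (hlam : lam ∈ multipliers f h G xbar) :
    HasFDerivAt (fun x => lagrangian f h G x lam) (0 : X →L[ℝ] ℝ) xbar := by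
  rw [← hlam.1]
  exact ((contDiff_lagrangian hf hh hG lam).differentiable (by norm_num) xbar).hasFDerivAt

/-- Squeeze between two functions that share the value at x̄ and have zero derivative there. -/
theorem hasFDerivAt_augLagrangian (hf : ContDiff ℝ 2 f) (hh : ContDiff ℝ 2 h)
    (hG : ContDiff ℝ 2 G) (hlam : lam ∈ multipliers f h G xbar) {ρ : ℝ} (hρ : 0 < ρ) :
    HasFDerivAt (fun x => augLagrangian f h G x lam ρ) (0 : X →L[ℝ] ℝ) xbar := by
  have h1 := hasFDerivAt_lagrangian hf hh hG hlam
  have h2 : HasFDerivAt (fun x => lagrangian f h G x lam +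
      ρ / 2 * ‖constraintMap h G x - constraintMap h G xbar‖ ^ 2) (0 : X →L[ℝ] ℝ) xbar := by
    have h3 := ((contDiff_constraintMap hh hG).differentiable (by norm_num) xbar).hasFDerivAt
    have h4 := h1.add (((h3.sub_const (constraintMap h G xbar)).norm_sq).const_mul (ρ / 2))
    convert! h4 using 1
    simp
  have h5 := h1.isLittleO
  have h6 := h2.isLittleO
  refine HasFDerivAt.of_isLittleO ?_
  refine Asymptotics.IsBigO.trans_isLittleO (Asymptotics.IsBigO.of_bound 1 ?_)
    (h5.norm_left.add h6.norm_left)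
  refine Eventually.of_forall fun x => ?_
  have h7 := lagrangian_le_augLagrangian hlam hρ x
  have h8 := augLagrangian_le_lagrangian_add hlam hρ x
  simp only [_root_.zero_apply, sub_zero, sub_self, norm_zero, ne_eq,
    OfNat.ofNat_ne_zero, not_false_eq_true, zero_pow, mul_zero, add_zero, one_mul,
    Real.norm_eq_abs, augLagrangian_eq_lagrangian hlam hρ]
  refine le_trans ?_ (le_abs_self _)
  refine abs_le.2 ⟨?_, ?_⟩
  · linarith [neg_abs_le (lagrangian f h G x lam - lagrangian f h G xbar lam),
      abs_nonneg (lagrangian f h G x lam +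
        ρ / 2 * ‖constraintMap h G x - constraintMap h G xbar‖ ^ 2 -
          lagrangian f h G xbar lam)]
  · linarith [abs_nonneg (lagrangian f h G x lam - lagrangian f h G xbar lam),
      le_abs_self (lagrangian f h G x lam +
        ρ / 2 * ‖constraintMap h G x - constraintMap h G xbar‖ ^ 2 -
          lagrangian f h G xbar lam)]

end Program

/-! ### Second order upper bound and the sequential argument. -/

section SecondOrder

variable {X Y : Type*} [NormedAddCommGroup X] [InnerProductSpace ℝ X]
  [NormedAddCommGroup Y] [InnerProductSpace ℝ Y] {n : ℕ}
  {f : X → ℝ} {h : X → Y} {G : X → SymMat n} {xbar : X} {lam : Dual Y n}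

/-- In a critical direction the second semiderivative of the augmented Lagrangian is at most the
quadratic form of the second order sufficient condition. -/
theorem secondSemideriv_augLagrangian_le (hf : ContDiff ℝ 2 f) (hh : ContDiff ℝ 2 h)
    (hG : ContDiff ℝ 2 G) (hlam : lam ∈ multipliers f h G xbar) {ρ : ℝ} (hρ : 0 < ρ) {d : X}
    (hd : d ∈ programCriticalCone h G xbar lam.snd) :
    secondSemideriv (fun x => augLagrangian f h G x lam ρ) xbar d ≤
      ((fderiv ℝ (fderiv ℝ (fun x' => lagrangian f h G x' lam)) xbar d d
        - sigmaTerm (G xbar) lam.snd (fderiv ℝ G xbar d) : ℝ) : EReal) := by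
  obtain ⟨hd1, hd2, hd3⟩ := hd
  set D := fderiv ℝ G xbar d with hD
  have hΓA : lam.snd.mat * (G xbar).mat = 0 := by
    have h1 := neg_mul_eq_zero_of_mem_multipliers hlam
    rwa [Matrix.neg_mul, neg_eq_zero] at h1
  obtain ⟨S, hS, hmem⟩ := exists_second_order_lift hlam.2.2.1 hd2 lam.snd.isSymm.eq hΓA
  have hσ : sigmaTerm (G xbar) lam.snd D = 2 * inner ℝ lam.snd S := by
    rw [sigmaTerm, frob, lam.snd.isSymm.eq, SymMat.inner_eq_trace, hS]
  have hΦ := contDiff_constraintMap hh hG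
  have hΦd : fderiv ℝ (constraintMap h G) xbar d = WithLp.toLp 2 (0, D) := by
    rw [fderiv_constraintMap (hh.differentiable (by norm_num) _)
      (hG.differentiable (by norm_num) _), hd1]
  let z : ℝ → Dual Y n := fun t => constraintMap h G xbar + t • WithLp.toLp 2 (0, D) +
    t ^ 2 • WithLp.toLp 2 (0, S)
  have hz : ∀ t > 0, z t ∈ constraintCone Y n := by
    intro t ht
    refine ⟨?_, hmem t ht.le⟩
    change h xbar + t • (0 : Y) + t ^ 2 • (0 : Y) = 0
    rw [hlam.2.1, smul_zero, smul_zero, add_zero, add_zero]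
  have hinner : ∀ t, inner ℝ lam (z t) = t ^ 2 * inner ℝ lam.snd S := by
    intro t
    simp only [z, inner_add_right, inner_smul_right, inner_constraintMap_of_mem_multipliers hlam,
      WithLp.prod_inner_apply, inner_zero_right, zero_add]
    change t * inner ℝ lam.snd D + t ^ 2 * inner ℝ lam.snd S = _
    rw [hd3, mul_zero, zero_add]
  have hlim1 := (contDiff_lagrangian hf hh hG lam).tendsto_second_order_quotient xbar
    (tendsto_id (x := 𝓝[>] (0 : ℝ))) (tendsto_const_nhds (x := d))
  have hlim2 := (hΦ.differentiable (by norm_num) xbar).hasFDerivAt.tendsto_inv_smul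
    (tendsto_id (x := 𝓝[>] (0 : ℝ))) (tendsto_const_nhds (x := d))
  have hid : Tendsto (fun t : ℝ => t) (𝓝[>] 0) (𝓝 0) := tendsto_id.mono_left nhdsWithin_le_nhds
  -- The curve matches Φ to first order, so the penalty divided by t² vanishes and ρ drops out of
  -- the limit.
  have hlim3 := ((hlim2.sub_const (WithLp.toLp 2 (0, D))).sub
    (hid.smul_const (WithLp.toLp 2 ((0 : Y), S)))).norm.pow 2
  rw [hΦd, sub_self, zero_smul, sub_self, norm_zero] at hlim3
  have hlim := ((hlim1.const_mul 2).sub_const (2 * inner ℝ lam.snd S)).add (hlim3.const_mul ρ)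
  refine secondSemideriv_le_of_tendsto (hasFDerivAt_augLagrangian hf hh hG hlam hρ)
    (b := fun t => 2 * ((t ^ 2)⁻¹ • (lagrangian f h G (xbar + t • d) lam -
      lagrangian f h G xbar lam - t • fderiv ℝ (fun x => lagrangian f h G x lam) xbar d)) -
      2 * inner ℝ lam.snd S +
      ρ * ‖t⁻¹ • (constraintMap h G (xbar + t • d) - constraintMap h G xbar) -
        WithLp.toLp 2 (0, D) - t • WithLp.toLp 2 ((0 : Y), S)‖ ^ 2) ?_ (fun t ht => ?_)
  · convert! hlim using 2
    rw [hσ, smul_eq_mul]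
    ring
  · have ht0 : t ≠ 0 := ne_of_gt ht
    have h1 := augLagrangian_le (f := f) (h := h) (G := G) (lam := lam) hρ (xbar + t • d) (hz t ht)
    have h2 : constraintMap h G (xbar + t • d) - z t =
        t • (t⁻¹ • (constraintMap h G (xbar + t • d) - constraintMap h G xbar) -
          WithLp.toLp 2 (0, D) - t • WithLp.toLp 2 ((0 : Y), S)) := by
      rw [smul_sub, smul_sub, smul_smul, smul_smul, mul_inv_cancel₀ ht0, one_smul, ← sq]
      simp only [z]
      abel
    rw [h2, norm_smul, mul_pow, Real.norm_eq_abs, sq_abs, hinner] at h1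
    simp only [augLagrangian_eq_lagrangian hlam hρ, hlam.1, _root_.zero_apply,
      smul_eq_mul]
    rw [div_le_iff₀ (by positivity)]
    refine (sub_le_sub_right h1 _).trans (le_of_eq ?_)
    field_simp
    ring

/-- Along sequences of points and multipliers, the second order sufficient condition excludes
augmented Lagrangians of vanishing quadratic growth. -/
theorem SOSC.not_vanishing_growth (hf : ContDiff ℝ 2 f) (hh : ContDiff ℝ 2 h)
    (hG : ContDiff ℝ 2 G) (hlam : lam ∈ multipliers f h G xbar) (hsosc : SOSC f h G xbar lam)
    {s ρ c : ℕ → ℝ} {u : ℕ → X} {lams z : ℕ → Dual Y n} {u₀ : X}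
    (hs : ∀ k, 0 < s k) (hs0 : Tendsto s atTop (𝓝 0)) (hu : Tendsto u atTop (𝓝 u₀))
    (hu₀ : u₀ ≠ 0) (hlams : ∀ k, lams k ∈ multipliers f h G xbar)
    (hlams_lim : Tendsto lams atTop (𝓝 lam)) (hρ : ∀ k, 0 < ρ k)
    (hρ_lim : Tendsto ρ atTop atTop) (hc : Tendsto c atTop (𝓝 0))
    (hz : ∀ k, z k ∈ constraintCone Y n)
    (hle : ∀ k, lagrangian f h G (xbar + s k • u k) (lams k) - inner ℝ (lams k) (z k) +
      ρ k / 2 * ‖constraintMap h G (xbar + s k • u k) - z k‖ ^ 2 ≤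
        lagrangian f h G xbar (lams k) + c k * s k ^ 2) : False := by
  have hsp : Tendsto s atTop (𝓝[>] 0) :=
    tendsto_nhdsWithin_iff.2 ⟨hs0, Eventually.of_forall hs⟩
  have hΦ := contDiff_constraintMap hh hG
  have hL := contDiff_lagrangian hf hh hG lam
  set q := fderiv ℝ (fderiv ℝ (fun x' => lagrangian f h G x' lam)) xbar u₀ u₀ with hq
  set Φ := constraintMap h G with hΦdef
  set D := fderiv ℝ G xbar u₀ with hD
  have hΦu : fderiv ℝ Φ xbar u₀ = WithLp.toLp 2 (fderiv ℝ h xbar u₀, D) :=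
    fderiv_constraintMap (hh.differentiable (by norm_num) _) (hG.differentiable (by norm_num) _) _
  -- the Lagrangian part
  let a : ℕ → ℝ := fun k => (s k ^ 2)⁻¹ * (lagrangian f h G (xbar + s k • u k) (lams k) -
    lagrangian f h G xbar (lams k))
  -- Both multipliers annihilate the gradient of their Lagrangian, and the two Lagrangians differ by
  -- ⟨λₖ - λ, Φ⟩. Without this cancellation, the first order part of that difference would be
  -- divided by sₖ², with no rate for λₖ → λ to control it.
  have hfderiv : ∀ k v, inner ℝ (lams k - lam) (fderiv ℝ Φ xbar v) = 0 := by
    intro k v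
    have h1 := (hasFDerivAt_lagrangian hf hh hG (hlams k)).sub
      (hasFDerivAt_lagrangian hf hh hG hlam)
    have h2 := (hasFDerivAt_const (lams k - lam) xbar).inner ℝ
      (hΦ.differentiable (by norm_num) xbar).hasFDerivAt
    have h3 : (fun x => lagrangian f h G x (lams k)) - (fun x => lagrangian f h G x lam) =
        fun x => inner ℝ (lams k - lam) (Φ x) := by
      ext x
      simp only [Pi.sub_apply, lagrangian_eq_inner, inner_sub_left]
      ring
    rw [h3] at h1
    have h4 := congrArg (fun T : X →L[ℝ] ℝ => T v) (h1.unique h2)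
    simpa [fderivInnerCLM_apply] using h4.symm
  have ha : Tendsto a atTop (𝓝 (q / 2)) := by
    have h1 := hL.tendsto_second_order_quotient xbar hsp hu
    have h2 := ((hlams_lim.sub_const lam).inner (𝕜 := ℝ)
      (hΦ.tendsto_second_order_quotient xbar hsp hu))
    have h3 := h1.add h2
    rw [sub_self, inner_zero_left, add_zero, smul_eq_mul, ← hq,
      show 1 / 2 * q = q / 2 by ring] at h3
    refine h3.congr fun k => ?_
    simp only [a, hlam.1, _root_.zero_apply, sub_zero, smul_eq_mul, inner_smul_right,
      inner_sub_right, hfderiv, mul_zero]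
    simp only [lagrangian_eq_inner, inner_sub_left, ← hΦdef]
    ring
  let b : ℕ → ℝ := fun k => -((s k ^ 2)⁻¹ * inner ℝ (lams k) (z k))
  have hb0 : ∀ k, 0 ≤ b k := fun k => by
    have h1 := inner_nonpos_of_mem_multipliers (hlams k) (hz k)
    have h2 : 0 ≤ (s k ^ 2)⁻¹ := by positivity
    simp only [b]
    nlinarith
  let r : ℕ → Dual Y n := fun k => (s k)⁻¹ • (Φ (xbar + s k • u k) - z k)
  have hsum : ∀ k, a k + b k + ρ k / 2 * ‖r k‖ ^ 2 ≤ c k := by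
    intro k
    have hk := hs k
    have h1 := mul_le_mul_of_nonneg_left (hle k) (by positivity : 0 ≤ (s k ^ 2)⁻¹)
    have h2 : ‖r k‖ ^ 2 = (s k ^ 2)⁻¹ * ‖Φ (xbar + s k • u k) - z k‖ ^ 2 := by
      simp only [r]
      rw [norm_smul, mul_pow, norm_inv, Real.norm_eq_abs, inv_pow, sq_abs]
    have h3 : (s k ^ 2)⁻¹ * (c k * s k ^ 2) = c k := by field_simp
    rw [mul_add _ (lagrangian f h G xbar (lams k)), h3] at h1
    rw [h2]
    simp only [a, b]
    linarith
  have hca := hc.sub ha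
  -- the constraint residual vanishes
  have hr : Tendsto r atTop (𝓝 0) := by
    have h1 : Tendsto (fun k => (c k - a k) * (2 * (ρ k)⁻¹)) atTop (𝓝 0) := by
      have h2 := hca.mul ((tendsto_inv_atTop_zero.comp hρ_lim).const_mul 2)
      simpa using h2
    have h3 : Tendsto (fun k => ‖r k‖ ^ 2) atTop (𝓝 0) := by
      refine squeeze_zero (fun k => by positivity) (fun k => ?_) h1
      have h4 := hsum k
      have h5 := hb0 k
      have h6 := hρ k
      rw [← div_eq_mul_inv, mul_div_assoc', le_div_iff₀ h6]
      linarith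
    rw [tendsto_zero_iff_norm_tendsto_zero]
    have h7 := h3.sqrt
    simpa [Real.sqrt_sq] using h7
  -- Since ⟨λₖ, eₖ⟩ = -sₖbₖ for the quotients eₖ below, this yields the orthogonality in the
  -- critical cone.
  have hsb : Tendsto (fun k => s k * b k) atTop (𝓝 0) := by
    refine squeeze_zero (fun k => mul_nonneg (hs k).le (hb0 k)) (fun k => ?_)
      (by simpa using hs0.mul hca)
    refine mul_le_mul_of_nonneg_left ?_ (hs k).le
    have h1 : 0 ≤ ρ k / 2 * ‖r k‖ ^ 2 := mul_nonneg (half_pos (hρ k)).le (by positivity)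
    linarith [hsum k]
  let e : ℕ → Dual Y n := fun k => (s k)⁻¹ • (z k - Φ xbar)
  have he : Tendsto e atTop (𝓝 (WithLp.toLp 2 (fderiv ℝ h xbar u₀, D))) := by
    have h1 := ((hΦ.differentiable (by norm_num) xbar).hasFDerivAt.tendsto_inv_smul hsp hu).sub hr
    rw [hΦu, sub_zero] at h1
    refine h1.congr fun k => ?_
    simp only [e, r]
    rw [← smul_sub]
    congr 1
    abel
  have he1 : ∀ k, (e k).fst = 0 := fun k => by
    change (s k)⁻¹ • ((z k).fst - h xbar) = 0
    rw [(hz k).1, hlam.2.1, sub_zero, smul_zero]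
  have hfst : fderiv ℝ h xbar u₀ = 0 := by
    have h1 := ((WithLp.continuous_fst 2 Y (SymMat n)).tendsto _).comp he
    refine tendsto_nhds_unique h1 ?_
    simp only [Function.comp_def, he1]
    exact tendsto_const_nhds
  let E : ℕ → SymMat n := fun k => (e k).snd
  have hE : Tendsto E atTop (𝓝 D) := ((WithLp.continuous_snd 2 Y (SymMat n)).tendsto _).comp he
  have hzE : ∀ k, G xbar + s k • E k = (z k).snd := fun k => by
    change G xbar + s k • (s k)⁻¹ • ((z k).snd - G xbar) = _
    rw [smul_smul, mul_inv_cancel₀ (hs k).ne', one_smul]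
    abel
  have hcrit : u₀ ∈ programCriticalCone h G xbar lam.snd := by
    refine ⟨hfst, ⟨s, E, hs, hs0, hE, fun k => ?_⟩, ?_⟩
    · rw [hzE]
      exact (hz k).2
    · have h1 : Tendsto (fun k => inner ℝ (lams k) (e k)) atTop (𝓝 0) := by
        have h2 := hsb.neg
        rw [neg_zero] at h2
        refine h2.congr fun k => ?_
        have h3 := (hs k).ne'
        simp only [b, e, inner_smul_right, inner_sub_right,
          inner_constraintMap_of_mem_multipliers (hlams k), hΦdef, sub_zero]
        field_simp
      have h4 := tendsto_nhds_unique (hlams_lim.inner (𝕜 := ℝ) he) h1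
      rw [hfst, inner_eq_trace_of_fst_eq_zero rfl] at h4
      rw [SymMat.inner_eq_trace]
      exact h4
  -- the lower bound for the multiplier term
  let B := pinv (G xbar)
  let N : ℕ → Matrix (Fin n) (Fin n) ℝ := fun k => -(lams k).snd.mat
  have hN : Tendsto N atTop (𝓝 (-lam.snd.mat)) :=
    ((SymMat.continuous_mat.comp (WithLp.continuous_snd 2 Y (SymMat n))).neg.tendsto _).comp
      hlams_lim
  have hEm : Tendsto (fun k => (E k).mat) atTop (𝓝 D.mat) :=
    (SymMat.continuous_mat.tendsto D).comp hE
  let m : ℕ → ℝ := fun k => 2 * (N k * (E k).mat * (B * D.mat)).trace -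
    (N k * (D.mat * B * D.mat)).trace -
    s k * (N k * (D.mat * B) * (E k).mat * (B * D.mat)).trace
  have hmb : ∀ k, m k ≤ b k := by
    intro k
    have h1 := trace_lower_bound_of_perturbation (G xbar) (E k) D (hlams k).2.2.2.2
      (neg_mul_eq_zero_of_mem_multipliers (hlams k)) (t := s k)
      (by rw [hzE]; exact (hz k).2)
    rw [hzE, Matrix.neg_mul _ (z k).snd.mat, Matrix.trace_neg,
      ← inner_eq_trace_of_fst_eq_zero (hz k).1] at h1
    have h2 : 0 < s k ^ 2 := pow_pos (hs k) 2
    simp only [b]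
    rw [← mul_neg, ← div_eq_inv_mul, le_div_iff₀ h2, mul_comm]
    exact h1
  have hm : Tendsto m atTop (𝓝 ((-lam.snd.mat * (D.mat * B * D.mat)).trace)) := by
    have tr : ∀ {g : ℕ → Matrix (Fin n) (Fin n) ℝ} {M : Matrix (Fin n) (Fin n) ℝ},
        Tendsto g atTop (𝓝 M) → Tendsto (fun k => (g k).trace) atTop (𝓝 M.trace) :=
      fun {g M} hg => ((continuous_id.matrix_trace).tendsto M).comp hg
    have h1 := ((tr ((hN.mul hEm).mul_const (B * D.mat))).const_mul 2).sub
      (tr (hN.mul_const (D.mat * B * D.mat)))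
    have h2 := h1.sub (hs0.mul
      (tr (((hN.mul_const (D.mat * B)).mul hEm).mul_const (B * D.mat))))
    convert! h2 using 2
    simp only [Matrix.mul_assoc]
    ring
  have hlim := ha.add hm
  have hfinal := le_of_tendsto_of_tendsto' hlim hc fun k => by
    have h1 : 0 ≤ ρ k / 2 * ‖r k‖ ^ 2 := mul_nonneg (half_pos (hρ k)).le (by positivity)
    linarith [hsum k, hmb k]
  have hpos := hsosc u₀ hcrit hu₀
  rw [sigmaTerm, frob, lam.snd.isSymm.eq] at hpos
  rw [Matrix.neg_mul, Matrix.trace_neg] at hfinal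
  change 0 < q - 2 * (lam.snd.mat * (D.mat * B * D.mat)).trace at hpos
  linarith

end SecondOrder

end NLSDP

/-! ### The equivalence. -/

theorem mainTheorem8 {X Y : Type*}
    [NormedAddCommGroup X] [InnerProductSpace ℝ X] [FiniteDimensional ℝ X]
    [NormedAddCommGroup Y] [InnerProductSpace ℝ Y] [FiniteDimensional ℝ Y] {n : ℕ}
    (f : X → ℝ) (h : X → Y) (G : X → NLSDP.SymMat n)
    (hf : ContDiff ℝ 2 f) (hh : ContDiff ℝ 2 h) (hG : ContDiff ℝ 2 G)
    (xbar : X) (hxbar : NLSDP.IsStationary f h G xbar)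
    (lamBar : NLSDP.Dual Y n) (hlamBar : lamBar ∈ NLSDP.multipliers f h G xbar) :
    NLSDP.SOSC f h G xbar lamBar ↔
      ∃ ρ₃ > (0 : ℝ), ∃ ε' > (0 : ℝ), ∃ l' > (0 : ℝ),
        ∀ lam ∈ NLSDP.multipliers f h G xbar ∩ Metric.closedBall lamBar ε',
          ∀ ρ : ℝ, ρ₃ ≤ ρ → ∀ w : X, w ≠ 0 →
            ((l' * ‖w‖ ^ 2 : ℝ) : EReal) ≤
              NLSDP.secondSemideriv (fun x => NLSDP.augLagrangian f h G x lam ρ) xbar w := by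
  constructor
  · intro hsosc
    by_contra! hcon
    have hpos : ∀ k : ℕ, (0 : ℝ) < 1 / ((k : ℝ) + 1) := fun k => Nat.one_div_pos_of_nat
    have hex : ∀ k : ℕ, ∃ (lam : NLSDP.Dual Y n) (ρ s : ℝ) (u : X) (z : NLSDP.Dual Y n),
        lam ∈ NLSDP.multipliers f h G xbar ∧ dist lam lamBar ≤ 1 / ((k : ℝ) + 1) ∧
        (k : ℝ) + 1 ≤ ρ ∧ 0 < s ∧ s < 1 / ((k : ℝ) + 1) ∧ ‖u‖ = 1 ∧
        z ∈ NLSDP.constraintCone Y n ∧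
        NLSDP.lagrangian f h G (xbar + s • u) lam - inner ℝ lam z +
          ρ / 2 * ‖NLSDP.constraintMap h G (xbar + s • u) - z‖ ^ 2 ≤
          NLSDP.lagrangian f h G xbar lam + 2 * (1 / ((k : ℝ) + 1)) * s ^ 2 := by
      intro k
      -- Negate (b) with ρ₃ = k + 1 and ε' = l' = 1/(k + 1). The direction w is then discarded in
      -- favour of a unit vector u, so that compactness of the sphere applies.
      obtain ⟨lam, hlam, ρ, hρ, w, hw, hlt⟩ := hcon (k + 1) (by positivity)
        (1 / ((k : ℝ) + 1)) (hpos k) (1 / ((k : ℝ) + 1)) (hpos k)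
      have hρ0 : 0 < ρ := lt_of_lt_of_le (by positivity) hρ
      obtain ⟨s, u, hs, hsk, hu, hgrowth⟩ := NLSDP.exists_small_step_of_secondSemideriv_lt
        (NLSDP.hasFDerivAt_augLagrangian hf hh hG hlam.1 hρ0) hw (hpos k) (hpos k) hlt
      rw [sub_lt_iff_lt_add', NLSDP.augLagrangian_eq_lagrangian hlam.1 hρ0] at hgrowth
      obtain ⟨z, hz, hzlt⟩ := NLSDP.exists_lt_of_augLagrangian_lt hρ0 hgrowth
      exact ⟨lam, ρ, s, u, z, hlam.1, hlam.2, hρ, hs, hsk, hu, hz, hzlt.le⟩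
    choose lams ρ s u z hlams hdist hρ hs hsk hu hz hle using hex
    obtain ⟨u₀, hu₀, ψ, hψ, hlim⟩ := (isCompact_sphere (0 : X) 1).tendsto_subseq
      (fun k => mem_sphere_zero_iff_norm.2 (hu k))
    have hinv : Tendsto (fun k : ℕ => 1 / ((k : ℝ) + 1)) atTop (𝓝 0) :=
      tendsto_one_div_add_atTop_nhds_zero_nat
    have hψ' := hψ.tendsto_atTop
    have hs0 : Tendsto s atTop (𝓝 0) :=
      squeeze_zero (fun k => (hs k).le) (fun k => (hsk k).le) hinv
    have hlamlim : Tendsto lams atTop (𝓝 lamBar) :=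
      tendsto_iff_dist_tendsto_zero.2 (squeeze_zero (fun _ => dist_nonneg) hdist hinv)
    have hρlim : Tendsto ρ atTop atTop :=
      tendsto_atTop_mono hρ (tendsto_atTop_add_const_right _ _ tendsto_natCast_atTop_atTop)
    have hc : Tendsto (fun k : ℕ => 2 * (1 / ((k : ℝ) + 1))) atTop (𝓝 0) := by
      simpa using hinv.const_mul 2
    have hu₀' : u₀ ≠ 0 := norm_ne_zero_iff.1 (by
      rw [mem_sphere_zero_iff_norm.1 hu₀]; exact one_ne_zero)
    exact NLSDP.SOSC.not_vanishing_growth hf hh hG hlamBar hsosc (fun k => hs (ψ k))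
      (hs0.comp hψ') hlim hu₀' (fun k => hlams (ψ k)) (hlamlim.comp hψ')
      (fun k => lt_of_lt_of_le (by positivity) (hρ (ψ k))) (hρlim.comp hψ') (hc.comp hψ')
      (fun k => hz (ψ k)) (fun k => hle (ψ k))
  · rintro ⟨ρ₃, hρ₃, ε', hε', l', hl', H⟩ d hd hd0
    -- The single pair (λ̄, ρ₃) suffices for this direction.
    have h1 := H lamBar ⟨hlamBar, Metric.mem_closedBall_self hε'.le⟩ ρ₃ le_rfl d hd0
    have h2 := h1.trans (NLSDP.secondSemideriv_augLagrangian_le hf hh hG hlamBar hρ₃ hd)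
    have h3 : 0 < l' * ‖d‖ ^ 2 := mul_pos hl' (pow_pos (norm_pos_iff.2 hd0) 2)
    exact h3.trans_le (EReal.coe_le_coe_iff.1 h2)
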